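/- Let $N$ be an integer, let $n\ge 0$, let $f_1,\dots,f_n\in\mathbb Z[t]$ be non-constant polynomials with positive leading coefficients, and let $g_0,g_1,\dots,g_n\in\mathbb Q(t)$ be rational functions. Write $v_t$ for the $t$-adic valuation on $\mathbb Q(t)$, with $v_t(0)=+\infty$, and set $$M=\min_{0\le i\le n} v_t(g_i)\in\mathbb Z\cup\{+\infty\}.$$ Let $B_0,B_1,B_2,\dots$ be the Bernoulli numbers, defined by $\frac{x}{e^x-1}=\sum_{k\ge 0}B_k\frac{x^k}{k!}$. For rational numbers $a,b$ and a prime $p$, write $a\equiv b \bmod p^N$ if the $p$-adic valuation of $a-b$ is at least $N$ (the valuation of $0$ being $+\infty$). Suppose that all of the following conditions hold (no $m$ satisfies $m\le N-M$ if $M=+\infty$). 1. $$v_t\Bigl(g_0(t)-\Bigl(1-\frac1t\Bigr)\sum_{i\ge 1:\,f_i(1)=0}g_i(t)-\sum_{i\ge 1:\,f_i(1)\ge 2}\bigl(1-t^{f_i(1)-1}\bigr)\frac{B_{f_i(1)}}{f_i(1)}\,g_i(t)f_i(t)\Bigr)\ge N.$$ 2. For every even integer $k\le 0$ with $k\in\{f_1(1),\dots,f_n(1)\}$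 and every integer $m$ with $1\le m\le N-M$, $$v_t\Bigl(\sum_{i\ge 1:\,f_i(1)=k}g_i(t)f_i(t)^m\Bigr)\ge N+1-m.$$ 3. For every even integer $k>0$ with $k\in\{f_1(1),\dots,f_n(1)\}$ and every integer $m$ with $2\le m\le N-M$, $$v_t\Bigl(\sum_{i\ge 1:\,f_i(1)=k}g_i(t)\bigl(f_i(t)^m-k^{m-1}f_i(t)\bigr)\Bigr)\ge N+1-m.$$ Then for every sufficiently large prime $p$, $$\sum_{i=1}^n g_i(p)\,B_{f_i(p)}\equiv g_0(p) \bmod p^N.$$ -/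

import Mathlib

open Polynomial

section

open scoped RatFunc

/-- The `t`-adic valuation `v_t` on `ℚ(t)`, with `v_t(0) = ⊤`: the order at `t = 0` of the Laurent
expansion of a rational function. -/
noncomputable def tVal : AddValuation (RatFunc ℚ) (WithTop ℤ) :=
  (HahnSeries.addVal ℤ ℚ).comap (algebraMap (RatFunc ℚ) (LaurentSeries ℚ))

end

/-- An integer polynomial, regarded as an element of `ℚ(t)`. -/
noncomputable def toRatFunc (f : ℤ[X]) : RatFunc ℚ :=
  algebraMap ℚ[X] (RatFunc ℚ) (f.map (Int.castRingHom ℚ))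

/-- The congruence `a ≡ b mod p ^ N` of rational numbers: the `p`-adic valuation of `a - b` is at
least `N`, where the valuation of `0` is infinite. -/
def RatCongr (p : ℕ) (N : ℤ) (a b : ℚ) : Prop :=
  a = b ∨ N ≤ padicValRat p (a - b)

/-- The Bernoulli number `B_k` (with `B_1 = -1/2`), indexed by an integer `k`; only used for
`k ≥ 0`. -/
def bern (k : ℤ) : ℚ := bernoulli k.toNat

/-- The value `g(x)` of a rational function at a rational number that is not a pole. -/
noncomputable def evalAt (x : ℚ) (g : RatFunc ℚ) : ℚ := g.eval (RingHom.id ℚ) x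

/-! Since `f_i(p) ≡ f_i(1)` modulo `p - 1`, the sum splits according to `k = f_i(1)`, and each part
involves only indices in one class modulo `p - 1`. On such a class, for large indices `n`, `B_n`
agrees modulo `p^L` with a polynomial `Q(n)` whose `m`-th coefficient has valuation at least `m - 1`
(`exists_bernoulli_interpolation`), a polynomial form of Kummer's congruences. A bound `N + 1 - m`
on the `m`-th moment of the `f_i(p)` therefore kills the degree `m` contribution modulo `p^N`.

What survives is the main term. For `k = 0` it is `Q(0) = 1 - 1/p`; for `k ≠ 0`, `Q(0) ≡ 0`. For `k
> 0`, `Q(k) ≡ (1 - p^(k-1)) B_k`, and condition 3 allows `Q(n)` to be replaced by the linear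
function `n Q(k)/k`. For odd `k` everything vanishes. These are `valGe_class` and `valGe_class_pos`.

To build `Q`, note that `(1 - p^(n-1)) B_n` is the `p`-adic limit of `p^(-r-1) ∑ a^n` over `a <
p^(r+1)` prime to `p`. Put `n = k + (p-1)s` and expand `a^((p-1)s)` in powers of `a^(p-1) - 1`: the
coefficient of `(s choose j)` has valuation at least `j - 1` for `j < p - 1`, and `(s choose j)` is
a `p`-integral polynomial in `n`. The value `Q(0)` for `k ≠ 0` comes from `n = p^R k`, which tends
to `0` while the power sum becomes that of a nontrivial character.

Finally, `v_t(g) ≥ N` gives `v_p(g(p)) ≥ N` for large `p` (`eventually_valGe_evalAt`), which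
transfers the hypotheses. -/

open Filter
open scoped RatFunc

/-! ### Bounds on `p`-adic valuations -/

/-- The `p`-adic valuation of the rational number `x` is at least `N`. -/
def ValGe (p : ℕ) (N : ℤ) (x : ℚ) : Prop := padicNorm p x ≤ (p : ℚ) ^ (-N)

namespace ValGe

variable {p : ℕ} {N M : ℤ} {x y : ℚ}

theorem zero : ValGe p N 0 := by
  unfold ValGe
  rw [padicNorm.zero]
  positivity

theorem exists_bound (x : ℚ) : ∃ e : ℤ, ValGe p e x := by
  by_cases hx : x = 0
  · exact ⟨0, hx ▸ zero⟩
  · obtain ⟨z, hz⟩ := padicNorm.values_discrete (p := p) hx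
    exact ⟨z, hz.le⟩

variable [hp : Fact p.Prime]

theorem one_lt_cast : (1 : ℚ) < p := by exact_mod_cast hp.out.one_lt

theorem cast_ne_zero : (p : ℚ) ≠ 0 := by exact_mod_cast hp.out.ne_zero

theorem mono (h : ValGe p N x) (hM : M ≤ N) : ValGe p M x :=
  le_trans h (zpow_le_zpow_right₀ one_lt_cast.le (by omega))

theorem add (hx : ValGe p N x) (hy : ValGe p N y) : ValGe p N (x + y) :=
  padicNorm.nonarchimedean.trans (max_le hx hy)

theorem sub (hx : ValGe p N x) (hy : ValGe p N y) : ValGe p N (x - y) :=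
  padicNorm.sub.trans (max_le hx hy)

theorem sum {α : Type*} {F : α → ℚ} {s : Finset α} (h : ∀ i ∈ s, ValGe p N (F i)) :
    ValGe p N (∑ i ∈ s, F i) :=
  padicNorm.sum_le' h (by positivity)

theorem mul (hx : ValGe p N x) (hy : ValGe p M y) : ValGe p (N + M) (x * y) := by
  unfold ValGe
  rw [padicNorm.mul, neg_add, zpow_add₀ cast_ne_zero]
  exact mul_le_mul hx hy (padicNorm.nonneg _) (by positivity)

theorem mul_of_le {K : ℤ} (hx : ValGe p N x) (hy : ValGe p M y) (hK : K ≤ N + M) :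
    ValGe p K (x * y) :=
  (hx.mul hy).mono hK

theorem intCast (z : ℤ) : ValGe p 0 (z : ℚ) := by
  simpa [ValGe] using padicNorm.of_int (p := p) z

theorem natCast (z : ℕ) : ValGe p 0 (z : ℚ) := by
  simpa using intCast (p := p) z

theorem pow (hx : ValGe p N x) (m : ℕ) : ValGe p (m * N) (x ^ m) := by
  induction m with
  | zero => simpa using natCast (p := p) 1
  | succ m ih =>
    rw [pow_succ]
    exact ih.mul_of_le hx (by push_cast; linarith)

theorem pow_zero_le (hx : ValGe p 0 x) (m : ℕ) : ValGe p 0 (x ^ m) := by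
  simpa using hx.pow m

theorem of_dvd {n : ℕ} {z : ℤ} (h : (p : ℤ) ^ n ∣ z) : ValGe p n (z : ℚ) :=
  padicNorm.dvd_iff_norm_le.1 (by rwa [Nat.cast_pow])

theorem zpow_self (k : ℤ) : ValGe p k ((p : ℚ) ^ k) := by
  unfold ValGe
  rw [padicNorm.eq_zpow_of_nonzero (zpow_ne_zero _ cast_ne_zero), padicValRat.zpow,
    padicValRat.self hp.out.one_lt, mul_one]

theorem pow_self (k : ℕ) : ValGe p k ((p : ℚ) ^ k) := by
  simpa using zpow_self (p := p) k

theorem inv_unit (h : padicNorm p x = 1) : ValGe p 0 x⁻¹ := by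
  have := padicNorm.div (p := p) 1 x
  simp only [one_div, padicNorm.one, h] at this
  simp [ValGe, this]

theorem inv_natCast {m : ℕ} (h : ¬ p ∣ m) : ValGe p 0 (m : ℚ)⁻¹ :=
  inv_unit ((padicNorm.nat_eq_one_iff m).2 h)

theorem inv_intCast {m : ℤ} (h : ¬ (p : ℤ) ∣ m) : ValGe p 0 (m : ℚ)⁻¹ :=
  inv_unit ((padicNorm.int_eq_one_iff m).2 h)

theorem ratCongr (h : ValGe p N (x - y)) : RatCongr p N x y := by
  by_cases hx : x - y = 0
  · exact Or.inl (sub_eq_zero.1 hx)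
  · right
    rw [ValGe, padicNorm.eq_zpow_of_nonzero hx] at h
    have := (zpow_le_zpow_iff_right₀ (one_lt_cast (p := p))).1 h
    omega

end ValGe

/-! ### Power sums modulo prime powers and Bernoulli numbers -/

theorem sum_range_mul_eq {R : Type*} [AddCommMonoid R] (F : ℕ → R) (a b : ℕ) :
    ∑ n ∈ Finset.range (a * b), F n
      = ∑ i ∈ Finset.range a, ∑ j ∈ Finset.range b, F (i + a * j) := by
  rw [Finset.sum_comm]
  induction b with
  | zero => simp
  | succ b ih =>
    rw [Nat.mul_succ, Finset.sum_range_add, ih, Finset.sum_range_succ]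
    simp [add_comm]

/-- If `p` divides `c ∑_{x < p} x ^ l`, then `p ^ r` divides `c ∑_{x < p ^ r} x ^ l`. -/
theorem pow_dvd_mul_sum_range_pow {p : ℕ} (hp : p.Prime) (hp2 : p ≠ 2) {c : ℤ} {l : ℕ}
    (h : (p : ℤ) ∣ c * ∑ x ∈ Finset.range p, (x : ℤ) ^ l) (r : ℕ) :
    (p : ℤ) ^ r ∣ c * ∑ x ∈ Finset.range (p ^ r), (x : ℤ) ^ l := by
  induction r with
  | zero => simp
  | succ r ih =>
    -- The quadratic error `p^(2r)` below is divisible by `p^(r+1)` only when `r ≥ 1`.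
    rcases Nat.eq_zero_or_pos r with rfl | hr
    · simpa using h
    have key : ∀ y j : ℕ, (p : ℤ) ^ (r + 1) ∣
        ((y + p ^ r * j : ℕ) : ℤ) ^ l - ((y : ℤ) ^ l + l * (y : ℤ) ^ (l - 1) * p ^ r * j) := by
      intro y j
      obtain ⟨w, hw⟩ := (Polynomial.X ^ l : ℤ[X]).binomExpansion (y : ℤ) ((p : ℤ) ^ r * j)
      simp only [eval_pow, eval_X, derivative_X_pow, eval_mul] at hw
      push_cast
      rw [hw]
      have : (p : ℤ) ^ (r + 1) ∣ (p : ℤ) ^ r * (p : ℤ) ^ r := by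
        rw [← pow_add]
        exact pow_dvd_pow _ (by omega)
      obtain ⟨u, hu⟩ := this
      simp only [map_natCast, eval_natCast]
      exact ⟨w * u * j ^ 2, by linear_combination w * j ^ 2 * hu⟩
    -- The linear terms sum to a multiple of `p^r ∑ j`; oddness of `p` supplies the missing factor
    -- `p`.
    have hgauss : (p : ℤ) ∣ ∑ j ∈ Finset.range p, (j : ℤ) := by
      have h2 : (p : ℤ) ∣ (∑ j ∈ Finset.range p, (j : ℤ)) * 2 := by
        have := Finset.sum_range_id_mul_two p
        have h3 : ((∑ j ∈ Finset.range p, (j : ℤ)) * 2) = p * ((p - 1 : ℕ) : ℤ) := by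
          rw [← Nat.cast_sum, ← Nat.cast_mul, ← this]
          push_cast
          rfl
        exact ⟨_, h3⟩
      refine (IsCoprime.dvd_of_dvd_mul_right ?_ h2)
      have : Nat.Coprime p 2 := (Nat.coprime_primes hp Nat.prime_two).2 hp2
      exact_mod_cast Nat.isCoprime_iff_coprime.2 this
    have e : ∑ x ∈ Finset.range (p ^ (r + 1)), (x : ℤ) ^ l
        = (∑ y ∈ Finset.range (p ^ r), ∑ j ∈ Finset.range p,
            (((y + p ^ r * j : ℕ) : ℤ) ^ l - ((y : ℤ) ^ l + l * (y : ℤ) ^ (l - 1) * p ^ r * j)))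
          + p * ∑ y ∈ Finset.range (p ^ r), (y : ℤ) ^ l
          + p ^ r * (∑ j ∈ Finset.range p, (j : ℤ)) *
            ∑ y ∈ Finset.range (p ^ r), l * (y : ℤ) ^ (l - 1) := by
      rw [pow_succ, sum_range_mul_eq]
      simp only [Finset.sum_sub_distrib, Finset.sum_add_distrib, Finset.sum_const,
        Finset.card_range, nsmul_eq_mul, Finset.mul_sum, Finset.sum_mul]
      rw [Finset.sum_comm (s := Finset.range (p ^ r)) (t := Finset.range p)
        (f := fun y j => (l : ℤ) * (y : ℤ) ^ (l - 1) * p ^ r * j)]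
      rw [Finset.sum_comm (s := Finset.range (p ^ r)) (t := Finset.range p)
        (f := fun y j => (p : ℤ) ^ r * (j : ℤ) * (l * (y : ℤ) ^ (l - 1)))]
      have : ∀ j y : ℕ, (l : ℤ) * (y : ℤ) ^ (l - 1) * p ^ r * j
        = (p : ℤ) ^ r * (j : ℤ) * (l * (y : ℤ) ^ (l - 1)) := fun _ _ => by ring
      simp only [this]
      ring
    rw [e, mul_add, mul_add]
    refine dvd_add (dvd_add ?_ ?_) ?_
    · exact Dvd.dvd.mul_left (Finset.dvd_sum fun y _ => Finset.dvd_sum fun j _ => key y j) _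
    · rw [mul_left_comm, pow_succ']
      exact mul_dvd_mul_left _ ih
    · rw [pow_succ]
      exact Dvd.dvd.mul_left (Dvd.dvd.mul_right (mul_dvd_mul_left _ hgauss) _) _

theorem dvd_sum_range_pow_of_lt {p : ℕ} (hp : p.Prime) {l : ℕ} (hl : l < p - 1) :
    (p : ℤ) ∣ ∑ x ∈ Finset.range p, (x : ℤ) ^ l := by
  have := Fact.mk hp
  rw [← ZMod.intCast_zmod_eq_zero_iff_dvd]
  have h := FiniteField.sum_pow_lt_card_sub_one (ZMod p) l (by rwa [ZMod.card])
  rw [← h]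
  push_cast
  refine Finset.sum_bij (fun x _ => (x : ZMod p)) (by simp) ?_ ?_ (by simp)
  · intro a ha b hb hab
    rw [ZMod.natCast_eq_natCast_iff] at hab
    exact Nat.ModEq.eq_of_lt_of_lt hab (Finset.mem_range.1 ha) (Finset.mem_range.1 hb)
  · intro b _
    exact ⟨b.val, Finset.mem_range.2 b.val_lt, by simp⟩

/-- Power sums over `x < p ^ r` determine the Bernoulli numbers `p`-adically. -/
theorem eventually_valGe_sum_range_pow_sub_bernoulli (p : ℕ) [hp : Fact p.Prime] (n : ℕ) (L : ℤ) :
    ∀ᶠ r : ℕ in atTop, ValGe p L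
      ((∑ x ∈ Finset.range (p ^ r), (x : ℚ) ^ n) / (p : ℚ) ^ r - _root_.bernoulli n) := by
  -- In Faulhaber's formula the terms `i < n` carry `p^(r(n-i))`, which beats their fixed
  -- denominators.
  have h : ∀ i ∈ Finset.range n, ∀ᶠ r : ℕ in atTop,
      ValGe p L (_root_.bernoulli i * ((n + 1).choose i) / (n + 1) * ((p : ℚ) ^ r) ^ (n - i)) := by
    intro i hi
    obtain ⟨e, he⟩ := ValGe.exists_bound (p := p) (_root_.bernoulli i * ((n + 1).choose i) / (n + 1))
    filter_upwards [eventually_ge_atTop (L - e).toNat] with r hr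
    rw [← pow_mul]
    refine he.mul_of_le (ValGe.pow_self _) ?_
    have h1 : r ≤ r * (n - i) := Nat.le_mul_of_pos_right _ (by have := Finset.mem_range.1 hi; omega)
    omega
  filter_upwards [(eventually_all_finset _).2 h] with r hr
  have hp0 : (p : ℚ) ^ r ≠ 0 := pow_ne_zero _ ValGe.cast_ne_zero
  have e : (∑ x ∈ Finset.range (p ^ r), (x : ℚ) ^ n) / (p : ℚ) ^ r - _root_.bernoulli n
      = ∑ i ∈ Finset.range n,
        _root_.bernoulli i * ((n + 1).choose i) / (n + 1) * ((p : ℚ) ^ r) ^ (n - i) := by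
    rw [sum_range_pow, Finset.sum_range_succ, add_div, Finset.sum_div]
    have hn : (n : ℚ) + 1 ≠ 0 := by positivity
    have e1 : _root_.bernoulli n * ((n + 1).choose n) * ((p ^ r : ℕ) : ℚ) ^ (n + 1 - n) / (n + 1)
        / (p : ℚ) ^ r = _root_.bernoulli n := by
      rw [Nat.choose_succ_self_right, Nat.add_sub_cancel_left]
      push_cast
      field_simp
    rw [e1, add_sub_cancel_right]
    refine Finset.sum_congr rfl fun i hi => ?_
    have : n + 1 - i = (n - i) + 1 := by have := Finset.mem_range.1 hi; omega
    rw [this, pow_succ]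
    push_cast
    field_simp
  rw [e]
  exact ValGe.sum hr

theorem valGe_sum_range_pow {p : ℕ} [hp : Fact p.Prime] (hp2 : p ≠ 2) (l r : ℕ) :
    ValGe p (r - 1) (∑ x ∈ Finset.range (p ^ r), (x : ℚ) ^ l) := by
  have h := pow_dvd_mul_sum_range_pow hp.out hp2 (c := p) (l := l) (dvd_mul_right _ _) r
  have h1 : ValGe p r ((p * ∑ x ∈ Finset.range (p ^ r), (x : ℤ) ^ l : ℤ) : ℚ) :=
    ValGe.of_dvd h
  have h2 := (ValGe.zpow_self (p := p) (-1)).mul_of_le h1 (K := r - 1) (by omega)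
  have e : (p : ℚ) ^ (-1 : ℤ) * ((p * ∑ x ∈ Finset.range (p ^ r), (x : ℤ) ^ l : ℤ) : ℚ)
      = ∑ x ∈ Finset.range (p ^ r), (x : ℚ) ^ l := by
    have := ValGe.cast_ne_zero (p := p)
    push_cast
    rw [zpow_neg_one, inv_mul_cancel_left₀ this]
  rwa [e] at h2

theorem valGe_sum_range_pow_of_lt {p : ℕ} [hp : Fact p.Prime] (hp2 : p ≠ 2) {l : ℕ}
    (hl : l < p - 1) (r : ℕ) :
    ValGe p r (∑ x ∈ Finset.range (p ^ r), (x : ℚ) ^ l) := by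
  have h := pow_dvd_mul_sum_range_pow hp.out hp2 (c := 1) (l := l)
    (by simpa using dvd_sum_range_pow_of_lt hp.out hl) r
  have h1 : ValGe p r ((∑ x ∈ Finset.range (p ^ r), (x : ℤ) ^ l : ℤ) : ℚ) :=
    ValGe.of_dvd (by rwa [one_mul] at h)
  simpa using h1

/-- The part of von Staudt-Clausen needed here, read off from the limit of power sums. -/
theorem valGe_bernoulli {p : ℕ} [hp : Fact p.Prime] (hp2 : p ≠ 2) (n : ℕ) :
    ValGe p (-1) (_root_.bernoulli n) := by
  obtain ⟨r, hr⟩ := (eventually_valGe_sum_range_pow_sub_bernoulli p n (-1)).exists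
  have h1 := (valGe_sum_range_pow hp2 n r).mul_of_le (ValGe.zpow_self (-r)) (K := -1) (by omega)
  rw [zpow_neg, zpow_natCast, ← div_eq_mul_inv] at h1
  simpa using h1.sub hr

/-! ### Power sums over integers prime to `p` -/

/-- The sum of `F a` over the integers `0 ≤ a < p ^ (r + 1)` prime to `p`. -/
def primeToSum (p r : ℕ) (F : ℕ → ℚ) : ℚ :=
  ∑ a ∈ Finset.range (p - 1), ∑ x ∈ Finset.range (p ^ r), F (a + 1 + p * x)

/-- The normalized power sum `p ^ (-(r + 1)) ∑ a ^ n` over `a < p ^ (r + 1)` prime to `p`. -/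
def normPowSum (p r n : ℕ) : ℚ :=
  primeToSum p r (fun a => (a : ℚ) ^ n) / (p : ℚ) ^ (r + 1)

/-- The multiples of `p` contribute `p^n` times the shorter power sum; this is the source of the
Euler factor. -/
theorem normPowSum_eq {p : ℕ} [hp : Fact p.Prime] (r n : ℕ) :
    normPowSum p r n = (∑ x ∈ Finset.range (p ^ (r + 1)), (x : ℚ) ^ n) / (p : ℚ) ^ (r + 1)
      - (p : ℚ) ^ ((n : ℤ) - 1) * ((∑ x ∈ Finset.range (p ^ r), (x : ℚ) ^ n) / (p : ℚ) ^ r) := by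
  have hp0 := ValGe.cast_ne_zero (p := p)
  have h : ∑ x ∈ Finset.range (p ^ (r + 1)), (x : ℚ) ^ n
      = primeToSum p r (fun a => (a : ℚ) ^ n)
        + (p : ℚ) ^ n * ∑ x ∈ Finset.range (p ^ r), (x : ℚ) ^ n := by
    have hp1 : p - 1 + 1 = p := Nat.sub_add_cancel hp.out.one_le
    rw [pow_succ', sum_range_mul_eq]
    nth_rewrite 1 [← hp1]
    rw [Finset.sum_range_succ', primeToSum, Finset.mul_sum]
    congr 1
    refine Finset.sum_congr rfl fun x _ => ?_
    push_cast
    ring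
  rw [h, normPowSum, zpow_sub₀ hp0, zpow_natCast, zpow_one]
  field_simp
  ring

/-- The normalized power sums tend `p`-adically to `B_n` with its Euler factor at `p` removed. -/
theorem eventually_valGe_normPowSum_sub (p : ℕ) [hp : Fact p.Prime] (n : ℕ) (L : ℤ) :
    ∀ᶠ r : ℕ in atTop, ValGe p L
      (normPowSum p r n - (1 - (p : ℚ) ^ ((n : ℤ) - 1)) * _root_.bernoulli n) := by
  -- The extra `1` in `L + 1` pays for `p^(n-1) = p^(-1)` when `n = 0`.
  filter_upwards [eventually_valGe_sum_range_pow_sub_bernoulli p n (L + 1),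
    (tendsto_add_atTop_nat 1).eventually (eventually_valGe_sum_range_pow_sub_bernoulli p n L)]
    with r h1 h2
  rw [normPowSum_eq]
  have h3 := (ValGe.zpow_self (p := p) ((n : ℤ) - 1)).mul_of_le h1 (K := L) (by omega)
  convert h2.sub h3 using 1
  ring

theorem normPowSum_zero {p : ℕ} [hp : Fact p.Prime] (r : ℕ) :
    normPowSum p r 0 = 1 - 1 / (p : ℚ) := by
  have hp0 := ValGe.cast_ne_zero (p := p)
  rw [normPowSum_eq]
  simp [hp0]

/-- Sums of Teichmüller-type powers of a nontrivial character vanish. -/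
theorem pow_succ_dvd_sum_range_pow {p : ℕ} [hp : Fact p.Prime] {k : ℕ} (hk : ¬ (p - 1) ∣ k)
    (R : ℕ) : (p : ℤ) ^ (R + 1) ∣ ∑ a ∈ Finset.range (p - 1), ((a : ℤ) + 1) ^ (p ^ R * k) := by
  have hpow : ∀ a b : ℤ, (p : ℤ) ∣ a - b →
      (p : ℤ) ^ (R + 1) ∣ a ^ (p ^ R * k) - b ^ (p ^ R * k) := by
    intro a b hab
    rw [pow_mul, pow_mul]
    exact (dvd_sub_pow_of_dvd_sub hab R).trans (sub_dvd_pow_sub_pow _ _ _)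
  obtain ⟨c, hc⟩ := IsCyclic.exists_generator (α := (ZMod p)ˣ)
  have hck : c ^ k ≠ 1 := by
    intro h
    have h1 := orderOf_dvd_of_pow_eq_one h
    rw [orderOf_eq_card_of_forall_mem_zpowers hc, Nat.card_eq_fintype_card,
      ZMod.card_units] at h1
    exact hk h1
  set S : ℤ := ∑ u : (ZMod p)ˣ, ((u : ZMod p).val : ℤ) ^ (p ^ R * k) with hS
  have hSeq : ∑ a ∈ Finset.range (p - 1), ((a : ℤ) + 1) ^ (p ^ R * k) = S := by
    symm
    refine Finset.sum_bij (fun u _ => (u : ZMod p).val - 1) ?_ ?_ ?_ ?_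
    · intro u _
      have h1 := (u : ZMod p).val_lt
      have h2 : (u : ZMod p).val ≠ 0 := by simp
      simp only [Finset.mem_range]
      omega
    · intro u _ v _ huv
      have h2 : (u : ZMod p).val ≠ 0 := by simp
      have h3 : (v : ZMod p).val ≠ 0 := by simp
      exact Units.ext (ZMod.val_injective p (by omega))
    · intro a ha
      have ha' := Finset.mem_range.1 ha
      have hne : ((a + 1 : ℕ) : ZMod p) ≠ 0 := by
        rw [Ne, ZMod.natCast_eq_zero_iff]
        exact Nat.not_dvd_of_pos_of_lt (by omega) (by omega)
      refine ⟨Units.mk0 _ hne, Finset.mem_univ _, ?_⟩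
      rw [Units.val_mk0, ZMod.val_natCast_of_lt (by omega)]
      omega
    · intro u _
      have h2 : (u : ZMod p).val ≠ 0 := by simp
      congr 1
      omega
  rw [hSeq]
  set γ : ℤ := ((c : ZMod p).val : ℤ) ^ (p ^ R * k) with hγ
  -- Translation by the generator permutes the summands and multiplies each by `γ` modulo `p^(R+1)`.
  have h1 : (p : ℤ) ^ (R + 1) ∣ S * (γ - 1) := by
    have e : S = ∑ u : (ZMod p)ˣ, (((u * c : (ZMod p)ˣ) : ZMod p).val : ℤ) ^ (p ^ R * k) :=
      (Fintype.sum_equiv (Equiv.mulRight c) _ _ fun _ => rfl).symm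
    rw [mul_sub, mul_one]
    nth_rewrite 2 [e]
    rw [hS, Finset.sum_mul, ← Finset.sum_sub_distrib]
    refine Finset.dvd_sum fun u _ => ?_
    rw [hγ, ← mul_pow]
    refine hpow _ _ ?_
    rw [← ZMod.intCast_eq_intCast_iff_dvd_sub]
    simp
  refine IsCoprime.dvd_of_dvd_mul_right ?_ h1
  refine IsCoprime.pow_left ((Nat.prime_iff_prime_int.1 hp.out).coprime_iff_not_dvd.2 ?_)
  -- Modulo `p` the exponent `p^R` acts trivially, so `γ ≡ c^k`, which is not `1`.
  intro h
  rw [← ZMod.intCast_zmod_eq_zero_iff_dvd] at h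
  push_cast [hγ] at h
  rw [ZMod.natCast_zmod_val, pow_mul, ZMod.pow_card_pow, sub_eq_zero] at h
  exact hck (Units.ext (by simpa using h))

/-- Modulo `p^(R+1)`, `a^(p^R k)` depends only on `a` modulo `p`, so the sum reduces to `p^r` copies
of the character sum. -/
theorem valGe_normPowSum_of_not_dvd {p : ℕ} [hp : Fact p.Prime] {k : ℕ} (hk : ¬ (p - 1) ∣ k)
    (r R : ℕ) : ValGe p (R - r) (normPowSum p r (p ^ R * k)) := by
  have hdvd : (p : ℤ) ^ (R + 1) ∣ ∑ a ∈ Finset.range (p - 1), ∑ x ∈ Finset.range (p ^ r),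
      ((a + 1 + p * x : ℕ) : ℤ) ^ (p ^ R * k) := by
    have e : ∑ a ∈ Finset.range (p - 1), ∑ x ∈ Finset.range (p ^ r),
        ((a + 1 + p * x : ℕ) : ℤ) ^ (p ^ R * k)
        = (∑ a ∈ Finset.range (p - 1), ∑ x ∈ Finset.range (p ^ r),
          (((a + 1 + p * x : ℕ) : ℤ) ^ (p ^ R * k) - ((a : ℤ) + 1) ^ (p ^ R * k)))
          + p ^ r * ∑ a ∈ Finset.range (p - 1), ((a : ℤ) + 1) ^ (p ^ R * k) := by
      simp only [Finset.sum_sub_distrib, Finset.sum_const, Finset.card_range, nsmul_eq_mul,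
        ← Finset.mul_sum]
      push_cast
      ring
    rw [e]
    refine dvd_add (Finset.dvd_sum fun a _ => Finset.dvd_sum fun x _ => ?_)
      (Dvd.dvd.mul_left (pow_succ_dvd_sum_range_pow hk R) _)
    rw [pow_mul, pow_mul]
    refine (dvd_sub_pow_of_dvd_sub ?_ R).trans (sub_dvd_pow_sub_pow _ _ _)
    exact ⟨x, by push_cast; ring⟩
  have h1 : ValGe p (R + 1) (primeToSum p r fun a => (a : ℚ) ^ (p ^ R * k)) := by
    have := ValGe.of_dvd (p := p) (n := R + 1) hdvd
    simpa [primeToSum] using this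
  have h2 := h1.mul_of_le (ValGe.zpow_self (-(r + 1 : ℤ))) (K := R - r) (by omega)
  rw [zpow_neg, ← div_eq_mul_inv, ← Nat.cast_succ, zpow_natCast] at h2
  exact h2

/-! ### Polynomials with `p`-adically small coefficients -/

/-- The `l`-th coefficient of `P` is divisible by `p ^ max j l` for every `l`. -/
def DivCoeff (p j : ℕ) (P : ℤ[X]) : Prop := ∀ l, (p : ℤ) ^ max j l ∣ P.coeff l

namespace DivCoeff

variable {p i j : ℕ} {P Q : ℤ[X]}

theorem mul (hP : DivCoeff p i P) (hQ : DivCoeff p j Q) : DivCoeff p (i + j) (P * Q) := by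
  intro l
  rw [coeff_mul]
  refine Finset.dvd_sum fun x hx => ?_
  refine dvd_trans (pow_dvd_pow _ ?_) (pow_add (p : ℤ) _ _ ▸ mul_dvd_mul (hP x.1) (hQ x.2))
  have := Finset.HasAntidiagonal.mem_antidiagonal.1 hx
  omega

theorem one : DivCoeff p 0 1 := by
  intro l
  rcases l with _ | l <;> simp [coeff_one]

theorem pow (hP : DivCoeff p i P) (n : ℕ) : DivCoeff p (n * i) (P ^ n) := by
  induction n with
  | zero => simpa using one
  | succ n ih =>
    rw [pow_succ, Nat.succ_mul]
    exact ih.mul hP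

theorem linear (a : ℤ) : DivCoeff p 0 (C a + C (p : ℤ) * X) := by
  intro l
  rw [coeff_add, coeff_C, coeff_C_mul, coeff_X]
  rcases l with _ | _ | l <;> simp

theorem linear_pow (a : ℤ) (n : ℕ) : DivCoeff p 0 ((C a + C (p : ℤ) * X) ^ n) := by
  simpa using (linear (p := p) a).pow n

/-- Only the constant coefficient gains from subtracting `1`; in degree `l ≥ 1` the factor `p^l`
already suffices. -/
theorem linear_pow_sub_one {a : ℤ} (ha : (p : ℤ) ∣ a ^ (p - 1) - 1) :
    DivCoeff p 1 ((C a + C (p : ℤ) * X) ^ (p - 1) - 1) := by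
  intro l
  rcases l with _ | l
  · simpa [coeff_zero_eq_eval_zero] using ha
  · have h := linear_pow (p := p) a (p - 1) (l + 1)
    rw [coeff_sub, coeff_one, if_neg (by omega), sub_zero]
    refine dvd_trans (pow_dvd_pow _ ?_) h
    omega

variable [hp : Fact p.Prime]

theorem valGe_coeff (hP : DivCoeff p j P) (l : ℕ) : ValGe p (max j l) (P.coeff l : ℚ) := by
  have := ValGe.of_dvd (p := p) (n := max j l) (hP l)
  exact_mod_cast this

theorem sum_eval_eq (m : ℕ) (P : ℤ[X]) : ∑ x ∈ Finset.range m, ((P.eval (x : ℤ) : ℤ) : ℚ)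
    = ∑ l ∈ P.support, (P.coeff l : ℚ) * ∑ x ∈ Finset.range m, (x : ℚ) ^ l := by
  simp only [eval_eq_sum, Polynomial.sum, Finset.mul_sum]
  push_cast
  exact Finset.sum_comm

theorem valGe_sum_eval (hp2 : p ≠ 2) (hP : DivCoeff p j P) (r : ℕ) :
    ValGe p (j + r - 1) (∑ x ∈ Finset.range (p ^ r), ((P.eval (x : ℤ) : ℤ) : ℚ)) := by
  rw [sum_eval_eq]
  exact ValGe.sum fun l _ => (hP.valGe_coeff l).mul_of_le (valGe_sum_range_pow hp2 l r) (by omega)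

theorem valGe_sum_eval_of_lt (hp2 : p ≠ 2) (hj : j < p - 1) (hP : DivCoeff p j P) (r : ℕ) :
    ValGe p (j + r) (∑ x ∈ Finset.range (p ^ r), ((P.eval (x : ℤ) : ℤ) : ℚ)) := by
  rw [sum_eval_eq]
  refine ValGe.sum fun l _ => ?_
  by_cases hl : l < p - 1
  · exact (hP.valGe_coeff l).mul_of_le (valGe_sum_range_pow_of_lt hp2 hl r) (by omega)
  -- Here `l ≥ p - 1 > j`, so `p^l` makes up for the factor `p` lost in the power sum.
  · exact (hP.valGe_coeff l).mul_of_le (valGe_sum_range_pow hp2 l r) (by omega)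

end DivCoeff

/-! ### Newton interpolation of power sums -/

/-- The `j`-th forward difference at `k`, with step `p - 1`, of the normalized power sums. -/
def normDiffSum (p r k j : ℕ) : ℚ :=
  primeToSum p r (fun a => (a : ℚ) ^ k * ((a : ℚ) ^ (p - 1) - 1) ^ j) / (p : ℚ) ^ (r + 1)

section

variable {p : ℕ} [hp : Fact p.Prime]

theorem exists_divCoeff (k j : ℕ) {a : ℕ} (ha : a < p - 1) : ∃ P : ℤ[X], DivCoeff p j P ∧
    ∀ x : ℕ, ((P.eval (x : ℤ) : ℤ) : ℚ) = ((a + 1 + p * x : ℕ) : ℚ) ^ k *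
      (((a + 1 + p * x : ℕ) : ℚ) ^ (p - 1) - 1) ^ j := by
  have h : (p : ℤ) ∣ ((a + 1 : ℕ) : ℤ) ^ (p - 1) - 1 := by
    rw [← ZMod.intCast_zmod_eq_zero_iff_dvd]
    push_cast
    rw [sub_eq_zero]
    refine ZMod.pow_card_sub_one_eq_one ?_
    have : ((a + 1 : ℕ) : ZMod p) ≠ 0 := by
      rw [Ne, ZMod.natCast_eq_zero_iff]
      exact Nat.not_dvd_of_pos_of_lt (by omega) (by omega)
    simpa using this
  refine ⟨(C ((a + 1 : ℕ) : ℤ) + C (p : ℤ) * X) ^ k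
    * ((C ((a + 1 : ℕ) : ℤ) + C (p : ℤ) * X) ^ (p - 1) - 1) ^ j, ?_, ?_⟩
  · have := (DivCoeff.linear_pow (p := p) ((a + 1 : ℕ) : ℤ) k).mul
      ((DivCoeff.linear_pow_sub_one h).pow j)
    rwa [zero_add, mul_one] at this
  · intro x
    simp only [eval_mul, eval_pow, eval_sub, eval_add, eval_C, eval_X, eval_one]
    push_cast
    rfl

/-- The bound, one weaker than `valGe_normDiffSum_of_lt`, holds for all `j` and serves to discard
the tail of the Newton expansion. -/
theorem valGe_normDiffSum (hp2 : p ≠ 2) (r k j : ℕ) : ValGe p (j - 2) (normDiffSum p r k j) := by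
  have h1 : ValGe p (j + r - 1)
      (primeToSum p r (fun a => (a : ℚ) ^ k * ((a : ℚ) ^ (p - 1) - 1) ^ j)) := by
    refine ValGe.sum fun a ha => ?_
    obtain ⟨P, hP, e⟩ := exists_divCoeff (p := p) k j (Finset.mem_range.1 ha)
    simpa only [e] using hP.valGe_sum_eval hp2 r
  have h2 := h1.mul_of_le (ValGe.zpow_self (-((r + 1 : ℕ) : ℤ))) (K := j - 2) (by omega)
  rwa [zpow_neg, ← div_eq_mul_inv, zpow_natCast] at h2

theorem valGe_normDiffSum_of_lt (hp2 : p ≠ 2) (r k : ℕ) {j : ℕ} (hj : j < p - 1) :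
    ValGe p (j - 1) (normDiffSum p r k j) := by
  have h1 : ValGe p (j + r)
      (primeToSum p r (fun a => (a : ℚ) ^ k * ((a : ℚ) ^ (p - 1) - 1) ^ j)) := by
    refine ValGe.sum fun a ha => ?_
    obtain ⟨P, hP, e⟩ := exists_divCoeff (p := p) k j (Finset.mem_range.1 ha)
    simpa only [e] using hP.valGe_sum_eval_of_lt hp2 hj r
  have h2 := h1.mul_of_le (ValGe.zpow_self (-((r + 1 : ℕ) : ℤ))) (K := j - 1) (by omega)
  rwa [zpow_neg, ← div_eq_mul_inv, zpow_natCast] at h2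

/-- Newton expansion in `s`: the binomial theorem for `((a^(p-1) - 1) + 1)^s`. -/
theorem normPowSum_eq_sum_choose (p r k s : ℕ) :
    normPowSum p r (k + (p - 1) * s)
      = ∑ j ∈ Finset.range (s + 1), (s.choose j : ℚ) * normDiffSum p r k j := by
  have h : ∀ a : ℕ, (a : ℚ) ^ (k + (p - 1) * s) = ∑ j ∈ Finset.range (s + 1),
      (s.choose j : ℚ) * ((a : ℚ) ^ k * ((a : ℚ) ^ (p - 1) - 1) ^ j) := by
    intro a
    have e := add_pow ((a : ℚ) ^ (p - 1) - 1) 1 s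
    rw [sub_add_cancel] at e
    rw [pow_add, pow_mul, e, Finset.mul_sum]
    refine Finset.sum_congr rfl fun j _ => ?_
    rw [one_pow]
    ring
  simp only [normPowSum, normDiffSum, primeToSum, h]
  simp only [mul_div_assoc', ← Finset.sum_div, Finset.mul_sum]
  congr 1
  rw [Finset.sum_comm (s := Finset.range (s + 1))]
  refine Finset.sum_congr rfl fun a _ => ?_
  exact Finset.sum_comm

/-- The binomial coefficient `(s choose j)` as a `p`-integral polynomial in `k + (p - 1) s`. -/
theorem exists_choose_polynomial (k : ℕ) {j : ℕ} (hj : j < p) : ∃ P : ℚ[X],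
    P.natDegree ≤ j ∧ (∀ m, ValGe p 0 (P.coeff m)) ∧
      ∀ s : ℕ, P.eval ((k + (p - 1) * s : ℕ) : ℚ) = s.choose j := by
  induction j with
  | zero =>
    refine ⟨1, by simp, fun m => ?_, by simp⟩
    rw [coeff_one]
    split_ifs
    · simpa using ValGe.natCast (p := p) 1
    · exact ValGe.zero
  | succ j ih =>
    obtain ⟨P, hdeg, hintegral, heval⟩ := ih (by omega)
    have hp1 := hp.out.one_lt
    -- From `(s choose j+1) = (s choose j)(s - j)/(j + 1)` with `s = (n - k)/(p - 1)`: the new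
    -- factor is `α n - β`.
    set α : ℚ := (((p - 1) * (j + 1) : ℕ) : ℚ)⁻¹ with hα
    have hndvd : ¬ p ∣ (p - 1) * (j + 1) := by
      rw [hp.out.dvd_mul, not_or]
      exact ⟨Nat.not_dvd_of_pos_of_lt (by omega) (by omega),
        Nat.not_dvd_of_pos_of_lt (by omega) hj⟩
    have hαi : ValGe p 0 α := ValGe.inv_natCast hndvd
    set β : ℚ := α * ((k + (p - 1) * j : ℕ) : ℚ) with hβ
    have hβi : ValGe p 0 β := hαi.mul_of_le (ValGe.natCast _) (by simp)
    refine ⟨P * (C α * X - C β), ?_, ?_, ?_⟩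
    · refine natDegree_mul_le.trans (add_le_add hdeg ?_)
      refine (natDegree_sub_le _ _).trans ?_
      simp only [natDegree_C, max_le_iff, zero_le, and_true]
      exact (natDegree_C_mul_le α X).trans natDegree_X_le
    · intro m
      rw [mul_sub, coeff_sub, coeff_mul_C, mul_comm (C α), ← mul_assoc, coeff_mul_C]
      refine ValGe.sub (ValGe.mul_of_le (N := 0) ?_ hαi (by simp)) ((hintegral m).mul_of_le hβi (by simp))
      rcases m with _ | m
      · simpa using ValGe.zero
      · simpa using hintegral m
    · intro s
      have hne : (((p - 1) * (j + 1) : ℕ) : ℚ) ≠ 0 := by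
        have : 0 < (p - 1) * (j + 1) := Nat.mul_pos (by omega) (by omega)
        exact_mod_cast this.ne'
      rw [eval_mul, heval]
      simp only [eval_sub, eval_mul, eval_C, eval_X]
      have h1 : (s.choose (j + 1) : ℚ) * (j + 1) = s.choose j * ((s : ℚ) - j) := by
        rcases le_or_gt j s with h | h
        · have := Nat.choose_succ_right_eq s j
          rw [← Nat.cast_sub h]
          exact_mod_cast this
        · simp [Nat.choose_eq_zero_of_lt h, Nat.choose_eq_zero_of_lt (h.trans (Nat.lt_succ_self j))]
      rw [hβ, hα]
      push_cast at hne ⊢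
      have hne1 : ((p - 1 : ℕ) : ℚ) ≠ 0 := left_ne_zero_of_mul hne
      field_simp
      linear_combination (-((p - 1 : ℕ) : ℚ)) * h1

/-- Interpolation of the normalized power sums along the residue class of `k` modulo `p - 1` by a
polynomial whose coefficients are `p`-adically small. -/
theorem exists_interpolation (r k L : ℕ) (hL : L + 3 ≤ p) : ∃ Q : ℚ[X],
    (∀ m : ℕ, ValGe p (m - 1) (Q.coeff m)) ∧
    (∀ s : ℕ, ValGe p L
      (normPowSum p r (k + (p - 1) * s) - Q.eval ((k + (p - 1) * s : ℕ) : ℚ))) ∧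
    (k = 0 → Q.coeff 0 = 1 - 1 / (p : ℚ)) ∧
    (¬ (p - 1) ∣ k → ValGe p L (Q.coeff 0)) := by
  have hp2 : p ≠ 2 := by omega
  have hex : ∀ j : ℕ, ∃ P : ℚ[X], j < p → P.natDegree ≤ j ∧ (∀ m, ValGe p 0 (P.coeff m)) ∧
      ∀ s : ℕ, P.eval ((k + (p - 1) * s : ℕ) : ℚ) = s.choose j := by
    intro j
    by_cases hj : j < p
    · obtain ⟨P, hP⟩ := exists_choose_polynomial (p := p) k hj
      exact ⟨P, fun _ => hP⟩
    · exact ⟨0, fun h => absurd h hj⟩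
  choose P hP using hex
  -- The tail `j ≥ L + 2` has valuation at least `L`; the kept `j ≤ L + 1` satisfy `j < p - 1`
  -- because `L + 3 ≤ p`.
  set Q : ℚ[X] := ∑ j ∈ Finset.range (L + 2), C (normDiffSum p r k j) * P j with hQ
  have hQeval : ∀ s : ℕ, Q.eval ((k + (p - 1) * s : ℕ) : ℚ)
      = ∑ j ∈ Finset.range (L + 2), (s.choose j : ℚ) * normDiffSum p r k j := by
    intro s
    rw [hQ, eval_finsetSum]
    refine Finset.sum_congr rfl fun j hj => ?_
    have := Finset.mem_range.1 hj
    rw [eval_mul, eval_C, (hP j (by omega)).2.2, mul_comm]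
  have hcoeff : ∀ m : ℕ, ValGe p (m - 1) (Q.coeff m) := by
    intro m
    rw [hQ, finsetSum_coeff]
    refine ValGe.sum fun j hj => ?_
    have hj' := Finset.mem_range.1 hj
    obtain ⟨hdeg, hintegral, -⟩ := hP j (by omega)
    rw [coeff_C_mul]
    by_cases hm : m ≤ j
    · exact (valGe_normDiffSum_of_lt hp2 r k (by omega)).mul_of_le (hintegral m) (by omega)
    · rw [coeff_eq_zero_of_natDegree_lt (by omega), mul_zero]
      exact ValGe.zero
  have hcongr : ∀ s : ℕ, ValGe p L
      (normPowSum p r (k + (p - 1) * s) - Q.eval ((k + (p - 1) * s : ℕ) : ℚ)) := by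
    intro s
    rw [hQeval, normPowSum_eq_sum_choose]
    have hterm : ∀ j, L + 2 ≤ j → ValGe p L ((s.choose j : ℚ) * normDiffSum p r k j) :=
      fun j hj => (ValGe.natCast _).mul_of_le (valGe_normDiffSum hp2 r k j) (by omega)
    rcases le_total (s + 1) (L + 2) with h | h
    · have : ∑ j ∈ Finset.range (L + 2), (s.choose j : ℚ) * normDiffSum p r k j
          = ∑ j ∈ Finset.range (s + 1), (s.choose j : ℚ) * normDiffSum p r k j := by
        symm
        refine Finset.sum_subset (Finset.range_mono h) fun j _ hj => ?_
        rw [Nat.choose_eq_zero_of_lt (by simpa using hj)]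
        simp
      rw [this, sub_self]
      exact ValGe.zero
    · rw [← Finset.sum_sdiff (Finset.range_mono h), add_sub_cancel_right]
      refine ValGe.sum fun j hj => hterm j ?_
      simp only [Finset.mem_sdiff, Finset.mem_range] at hj
      omega
  refine ⟨Q, hcoeff, hcongr, ?_, ?_⟩
  · rintro rfl
    have h := hQeval 0
    rw [Finset.sum_range_succ'] at h
    have h0 : normDiffSum p r 0 0 = 1 - 1 / (p : ℚ) := by
      rw [← normPowSum_zero (p := p) r]
      simp [normDiffSum, normPowSum]
    rw [coeff_zero_eq_eval_zero]
    simpa [h0] using h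
  · intro hk
    -- With `r` fixed, this makes both the power sum at `n = p^R k` and `n` itself divisible by
    -- `p^L`; also `n ≡ k` modulo `p - 1`.
    set R := L + r + 1 with hR
    have hpR : 1 ≤ p ^ R := Nat.one_le_pow _ _ hp.out.pos
    obtain ⟨u, hu⟩ : (p - 1) ∣ p ^ R - 1 := by
      simpa using Nat.sub_dvd_pow_sub_pow p 1 R
    have hn : p ^ R * k = k + (p - 1) * (u * k) := by
      rw [← mul_assoc, ← hu, Nat.sub_mul, one_mul]
      have : k ≤ p ^ R * k := Nat.le_mul_of_pos_left _ hpR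
      omega
    have h1 := hcongr (u * k)
    rw [← hn] at h1
    have h2 : ValGe p L (normPowSum p r (p ^ R * k)) :=
      (valGe_normPowSum_of_not_dvd hk r R).mono (by omega)
    have h3 : ValGe p L (Q.eval ((p ^ R * k : ℕ) : ℚ)) := by
      simpa using h2.sub h1
    have h4 : ValGe p L (Q.divX.eval ((p ^ R * k : ℕ) : ℚ) * ((p ^ R * k : ℕ) : ℚ)) := by
      have hx : ValGe p R ((p ^ R * k : ℕ) : ℚ) := by
        push_cast
        exact (ValGe.pow_self R).mul_of_le (ValGe.natCast k) (by simp)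
      refine ValGe.mul_of_le (N := 0) ?_ hx (by omega)
      rw [eval_eq_sum, Polynomial.sum]
      refine ValGe.sum fun m _ => ?_
      rw [coeff_divX]
      exact ((hcoeff (m + 1)).mono (M := 0) (by push_cast; omega)).mul_of_le
        ((ValGe.natCast (p ^ R * k)).pow_zero_le m) (by simp)
    have e : Q.coeff 0 = Q.eval ((p ^ R * k : ℕ) : ℚ)
        - Q.divX.eval ((p ^ R * k : ℕ) : ℚ) * ((p ^ R * k : ℕ) : ℚ) := by
      nth_rewrite 2 [← divX_mul_X_add Q]
      simp
    rw [e]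
    exact h3.sub h4

end

/-! ### From `t`-adic valuations to values at large primes -/

theorem tVal_X : tVal (RatFunc.X : RatFunc ℚ) = 1 := by
  change HahnSeries.addVal ℤ ℚ (algebraMap (RatFunc ℚ) (LaurentSeries ℚ) RatFunc.X) = 1
  rw [HahnSeries.addVal_apply, RatFunc.coe_X, HahnSeries.orderTop_single one_ne_zero]
  rfl

theorem tVal_C {c : ℚ} (hc : c ≠ 0) : tVal (RatFunc.C c) = 0 := by
  change HahnSeries.addVal ℤ ℚ (algebraMap (RatFunc ℚ) (LaurentSeries ℚ) (RatFunc.C c)) = 0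
  have : algebraMap (RatFunc ℚ) (LaurentSeries ℚ) (RatFunc.C c) = HahnSeries.C c := by
    rw [← RatFunc.algebraMap_C, ← IsScalarTower.algebraMap_apply]
    simp
  rw [HahnSeries.addVal_apply, this, HahnSeries.C_apply, HahnSeries.orderTop_single hc]
  rfl

theorem tVal_algebraMap_nonneg (q : ℚ[X]) : 0 ≤ tVal (algebraMap ℚ[X] (RatFunc ℚ) q) := by
  induction q using Polynomial.induction_on' with
  | add a b ha hb =>
    rw [map_add]
    exact (le_min ha hb).trans (AddValuation.map_add _ _ _)
  | monomial n c =>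
    rw [← C_mul_X_pow_eq_monomial, map_mul, map_pow, RatFunc.algebraMap_X, RatFunc.algebraMap_C,
      AddValuation.map_mul, AddValuation.map_pow, tVal_X]
    by_cases hc : c = 0
    · simp [hc]
    · rw [tVal_C hc, zero_add]
      positivity

theorem tVal_algebraMap_of_coeff_zero_ne {q : ℚ[X]} (hq : q.coeff 0 ≠ 0) :
    tVal (algebraMap ℚ[X] (RatFunc ℚ) q) = 0 := by
  refine le_antisymm ?_ (tVal_algebraMap_nonneg q)
  by_contra! h
  have h1 : 0 < tVal (algebraMap ℚ[X] (RatFunc ℚ) (q.divX * X)) := by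
    rw [map_mul, AddValuation.map_mul, RatFunc.algebraMap_X, tVal_X]
    exact lt_of_lt_of_le zero_lt_one (le_add_of_nonneg_left (tVal_algebraMap_nonneg _))
  have h2 : RatFunc.C (q.coeff 0) = algebraMap ℚ[X] (RatFunc ℚ) q
      - algebraMap ℚ[X] (RatFunc ℚ) (q.divX * X) := by
    rw [← map_sub, ← RatFunc.algebraMap_C]
    congr 1
    nth_rewrite 2 [← divX_mul_X_add q]
    ring
  have h3 := (lt_min h h1).trans_le (AddValuation.map_sub tVal _ _)
  rw [← h2, tVal_C hq] at h3
  exact lt_irrefl _ h3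

/-- If `t` divided the denominator, the coprime numerator would have valuation `0`, while `g *
denom` has valuation at least `1`. -/
theorem denom_coeff_zero_ne {g : RatFunc ℚ} (hg : 0 ≤ tVal g) : g.denom.coeff 0 ≠ 0 := by
  intro h0
  have hX : X ∣ g.denom := X_dvd_iff.2 h0
  have hn : g.num.coeff 0 ≠ 0 := by
    intro hn
    have := (RatFunc.isCoprime_num_denom g).isUnit_of_dvd' (X_dvd_iff.2 hn) hX
    exact not_isUnit_X this
  obtain ⟨d, hd⟩ := hX
  have h1 : g * algebraMap ℚ[X] (RatFunc ℚ) g.denom = algebraMap ℚ[X] (RatFunc ℚ) g.num := by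
    have := RatFunc.num_div_denom g
    rw [div_eq_iff ((map_ne_zero_iff _ (RatFunc.algebraMap_injective ℚ)).2 g.denom_ne_zero)] at this
    exact this.symm
  have h2 := congrArg tVal h1
  rw [tVal_algebraMap_of_coeff_zero_ne hn, AddValuation.map_mul, hd, map_mul,
    AddValuation.map_mul, RatFunc.algebraMap_X, tVal_X] at h2
  have h3 : (1 : WithTop ℤ) ≤ tVal g + (1 + tVal (algebraMap ℚ[X] (RatFunc ℚ) d)) :=
    le_add_of_nonneg_of_le hg (le_add_of_nonneg_right (tVal_algebraMap_nonneg d))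
  rw [h2] at h3
  exact absurd h3 (by decide)

/-- Rational numbers are `p`-integral for all large primes `p`. -/
theorem eventually_valGe_zero (c : ℚ) :
    ∀ᶠ p : ℕ in atTop, p.Prime → ValGe p 0 c := by
  filter_upwards [eventually_gt_atTop c.den] with p hp hpr
  have := Fact.mk hpr
  have h : ¬ p ∣ c.den := Nat.not_dvd_of_pos_of_lt c.pos hp
  rw [← Rat.num_div_den c, div_eq_mul_inv]
  exact (ValGe.intCast c.num).mul_of_le (ValGe.inv_natCast h) (by simp)

theorem eventually_valGe_eval (q : ℚ[X]) :
    ∀ᶠ p : ℕ in atTop, p.Prime → ValGe p 0 (q.eval (p : ℚ)) := by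
  have : ∀ᶠ p : ℕ in atTop, ∀ i ∈ q.support, p.Prime → ValGe p 0 (q.coeff i) :=
    (eventually_all_finset _).2 fun i _ => eventually_valGe_zero _
  filter_upwards [this] with p h hpr
  have := Fact.mk hpr
  rw [eval_eq_sum, Polynomial.sum]
  exact ValGe.sum fun i hi =>
    (h i hi hpr).mul_of_le ((ValGe.natCast p).pow_zero_le i) (by simp)

/-- For large `p`, `q(p) ≡ q(0)` modulo `p` and `q(0)` is a `p`-adic unit. -/
theorem eventually_padicNorm_eval {q : ℚ[X]} (hq : q.coeff 0 ≠ 0) :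
    ∀ᶠ p : ℕ in atTop, p.Prime → padicNorm p (q.eval (p : ℚ)) = 1 := by
  filter_upwards [eventually_valGe_zero (q.coeff 0)⁻¹, eventually_valGe_zero (q.coeff 0),
    eventually_valGe_eval q.divX] with p h1 h1' h2 hpr
  have := Fact.mk hpr
  have hc : padicNorm p (q.coeff 0) = 1 := by
    have a := h1 hpr
    have b := h1' hpr
    have e : padicNorm p (q.coeff 0)⁻¹ * padicNorm p (q.coeff 0) = 1 := by
      rw [← padicNorm.mul, inv_mul_cancel₀ hq, padicNorm.one]
    simp only [ValGe, neg_zero, zpow_zero] at a b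
    have := padicNorm.nonneg (p := p) (q.coeff 0)
    nlinarith
  have hd : ValGe p 1 (q.divX.eval (p : ℚ) * p) :=
    (h2 hpr).mul_of_le (by simpa using ValGe.zpow_self (p := p) 1) (by simp)
  have hlt : padicNorm p (q.divX.eval (p : ℚ) * p) < 1 := by
    refine lt_of_le_of_lt hd ?_
    rw [zpow_neg, zpow_one]
    exact inv_lt_one_of_one_lt₀ ValGe.one_lt_cast
  have e : q.eval (p : ℚ) = q.divX.eval (p : ℚ) * p + q.coeff 0 := by
    conv_lhs => rw [← divX_mul_X_add q]
    simp
  rw [e, padicNorm.add_eq_max_of_ne (by rw [hc]; exact hlt.ne), hc, max_eq_right hlt.le]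

theorem eventually_eval_ne_zero {q : ℚ[X]} (hq : q ≠ 0) :
    ∀ᶠ p : ℕ in atTop, q.eval (p : ℚ) ≠ 0 := by
  have h := (q.roots.toFinset.finite_toSet.preimage
    (Nat.cast_injective (R := ℚ)).injOn : (_ : Set ℕ).Finite)
  rw [← Nat.cofinite_eq_atTop]
  filter_upwards [h.compl_mem_cofinite] with p hp h0
  exact hp (by simp [hq, h0])

/-- Evaluation respects sums and products away from poles, and these are finite in number. -/
theorem eventually_denom_ne_zero (g : RatFunc ℚ) :
    ∀ᶠ p : ℕ in atTop, g.denom.eval₂ (RingHom.id ℚ) (p : ℚ) ≠ 0 := by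
  simpa [eval₂_id] using eventually_eval_ne_zero g.denom_ne_zero

theorem eventually_evalAt_add (a b : RatFunc ℚ) :
    ∀ᶠ p : ℕ in atTop, evalAt p (a + b) = evalAt p a + evalAt p b := by
  filter_upwards [eventually_denom_ne_zero a, eventually_denom_ne_zero b] with p ha hb
  exact RatFunc.eval_add _ _ ha hb

theorem eventually_evalAt_mul (a b : RatFunc ℚ) :
    ∀ᶠ p : ℕ in atTop, evalAt p (a * b) = evalAt p a * evalAt p b := by
  filter_upwards [eventually_denom_ne_zero a, eventually_denom_ne_zero b] with p ha hb
  exact RatFunc.eval_mul _ _ ha hb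

theorem evalAt_C (x c : ℚ) : evalAt x (RatFunc.C c) = c := RatFunc.eval_C _ _

theorem evalAt_X (x : ℚ) : evalAt x RatFunc.X = x := by simp [evalAt]

theorem evalAt_toRatFunc (p : ℕ) (f : ℤ[X]) :
    evalAt p (toRatFunc f) = ((f.eval (p : ℤ) : ℤ) : ℚ) := by
  simp [evalAt, toRatFunc, eval_map]

theorem eventually_evalAt_sub (a b : RatFunc ℚ) :
    ∀ᶠ p : ℕ in atTop, evalAt p (a - b) = evalAt p a - evalAt p b := by
  filter_upwards [eventually_evalAt_add (a - b) b] with p h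
  rw [sub_add_cancel] at h
  rw [h]
  ring

theorem eventually_evalAt_pow (a : RatFunc ℚ) (m : ℕ) :
    ∀ᶠ p : ℕ in atTop, evalAt p (a ^ m) = evalAt p a ^ m := by
  induction m with
  | zero => simp [evalAt]
  | succ m ih =>
    filter_upwards [ih, eventually_evalAt_mul (a ^ m) a] with p h1 h2
    rw [pow_succ, h2, h1, pow_succ]

theorem eventually_evalAt_sum {ι : Type*} (s : Finset ι) (a : ι → RatFunc ℚ) :
    ∀ᶠ p : ℕ in atTop, evalAt p (∑ i ∈ s, a i) = ∑ i ∈ s, evalAt p (a i) := by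
  classical
  induction s using Finset.induction_on with
  | empty => simp [evalAt]
  | insert i s hi ih =>
    filter_upwards [ih, eventually_evalAt_add (a i) (∑ i ∈ s, a i)] with p h1 h2
    rw [Finset.sum_insert hi, Finset.sum_insert hi, h2, h1]

theorem eventually_evalAt_X_zpow (k : ℤ) :
    ∀ᶠ p : ℕ in atTop, evalAt p (RatFunc.X ^ k) = (p : ℚ) ^ k := by
  obtain ⟨m, rfl | rfl⟩ := Int.eq_nat_or_neg k
  · filter_upwards [eventually_evalAt_pow RatFunc.X m] with p h
    simpa [evalAt_X] using h
  · filter_upwards [eventually_evalAt_pow RatFunc.X m, eventually_gt_atTop 0,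
      eventually_evalAt_mul (RatFunc.X ^ (-(m : ℤ))) (RatFunc.X ^ m)] with p h h0 h1
    rw [zpow_neg, zpow_natCast, inv_mul_cancel₀ (pow_ne_zero _ RatFunc.X_ne_zero), h, evalAt_X] at h1
    have h2 : (p : ℚ) ≠ 0 := by exact_mod_cast h0.ne'
    rw [zpow_neg, zpow_natCast, zpow_neg, zpow_natCast]
    refine eq_inv_of_mul_eq_one_left ?_
    rw [← h1]
    simp [evalAt]

/-- A lower bound for the `t`-adic valuation of `g` bounds the `p`-adic valuation of `g(p)` for
all large primes `p`. -/
theorem eventually_valGe_evalAt {g : RatFunc ℚ} {N : ℤ} (hg : (N : WithTop ℤ) ≤ tVal g) :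
    ∀ᶠ p : ℕ in atTop, p.Prime → ValGe p N (evalAt p g) := by
  have hX : tVal (RatFunc.X ^ N : RatFunc ℚ) = N := by
    obtain ⟨m, rfl | rfl⟩ := Int.eq_nat_or_neg N
    · rw [zpow_natCast, AddValuation.map_pow, tVal_X]
      simp
    · have h1 := congrArg tVal (inv_mul_cancel₀ (pow_ne_zero m (RatFunc.X_ne_zero (K := ℚ))))
      rw [AddValuation.map_mul, AddValuation.map_pow, tVal_X, AddValuation.map_one] at h1
      rw [zpow_neg, zpow_natCast]
      generalize tVal (RatFunc.X ^ m : RatFunc ℚ)⁻¹ = u at h1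
      induction u using WithTop.recTopCoe with
      | top => simp at h1
      | coe u =>
        have h2 : u + (m : ℤ) = 0 := by
          have : ((u + (m : ℤ) : ℤ) : WithTop ℤ) = ((0 : ℤ) : WithTop ℤ) := by
            simpa using h1
          exact_mod_cast this
        congr 1
        omega
  set u : RatFunc ℚ := g / RatFunc.X ^ N with hu
  have hgu : g = RatFunc.X ^ N * u := by
    rw [hu, mul_div_cancel₀ _ (zpow_ne_zero _ RatFunc.X_ne_zero)]
  have hu0 : 0 ≤ tVal u := by
    rw [hgu, AddValuation.map_mul, hX] at hg
    by_contra! h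
    generalize tVal u = w at h hg
    induction w using WithTop.recTopCoe with
    | top => simp at h
    | coe w =>
      have h1 : N ≤ N + w := by exact_mod_cast hg
      have h2 : w < 0 := by exact_mod_cast h
      omega
  filter_upwards [eventually_evalAt_mul (RatFunc.X ^ N) u, eventually_evalAt_X_zpow N,
    eventually_valGe_eval u.num, eventually_padicNorm_eval (denom_coeff_zero_ne hu0)]
    with p h1 h2 h3 h4 hpr
  have := Fact.mk hpr
  have h5 : ValGe p 0 (evalAt p u) := by
    rw [evalAt, RatFunc.eval, eval₂_id, eval₂_id, div_eq_mul_inv]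
    exact (h3 hpr).mul_of_le (ValGe.inv_unit (h4 hpr)) (by simp)
  rw [hgu, h1, h2]
  exact (ValGe.zpow_self N).mul_of_le h5 (by simp)

/-! ### Bernoulli numbers in one residue class -/

section

variable {p : ℕ} [hp : Fact p.Prime] {ι : Type*}

/-- Bernoulli numbers with indices in one residue class modulo `p - 1` are interpolated by a
polynomial whose coefficients are `p`-adically small. -/
theorem exists_bernoulli_interpolation {L : ℕ} (hL : L + 3 ≤ p) {k : ℤ} (hk : |k| < (p : ℤ) - 1)
    (s : Finset ι) {n : ι → ℕ} (hn : ∀ i ∈ s, L + 2 ≤ n i)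
    (hmod : ∀ i ∈ s, (p : ℤ) - 1 ∣ n i - k) : ∃ Q : ℚ[X],
    (∀ m : ℕ, ValGe p (m - 1) (Q.coeff m)) ∧
    (∀ i ∈ s, ValGe p L (_root_.bernoulli (n i) - Q.eval (n i : ℚ))) ∧
    (k = 0 → Q.coeff 0 = 1 - 1 / (p : ℚ)) ∧
    (k ≠ 0 → ValGe p L (Q.coeff 0)) ∧
    (0 < k → ValGe p L ((1 - (p : ℚ) ^ (k - 1)) * bern k - Q.eval (k : ℚ))) := by
  have hp2 : p ≠ 2 := by omega
  obtain ⟨hk1, hk2⟩ := abs_lt.1 hk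
  have hpc : ((p - 1 : ℕ) : ℤ) = (p : ℤ) - 1 := by
    have := hp.out.one_le
    push_cast [this]
    ring
  -- A negative `k` is shifted once by `p - 1` to get an exponent; `k₀ = 0` only if `k = 0`.
  obtain ⟨k₀, hk₀, hlt⟩ : ∃ k₀ : ℕ, ((k₀ : ℤ) = k ∧ 0 ≤ k ∨ (k₀ : ℤ) = k + (p - 1) ∧ k < 0) ∧
      (k₀ : ℤ) < p - 1 := by
    rcases le_or_gt 0 k with h | h
    · exact ⟨k.toNat, by omega, by omega⟩
    · exact ⟨(k + (p - 1)).toNat, by omega, by omega⟩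
  have hclass : ∀ i ∈ s, n i = k₀ + (p - 1) * (n i / (p - 1)) := by
    intro i hi
    have h1 : (p : ℤ) - 1 ∣ n i - k₀ := by
      rcases hk₀ with ⟨h, -⟩ | ⟨h, -⟩
      · rw [h]
        exact hmod i hi
      · rw [h, ← sub_sub]
        exact dvd_sub (hmod i hi) dvd_rfl
    have h2 : k₀ ≡ n i [MOD (p - 1)] := by
      rw [Nat.modEq_iff_dvd, hpc]
      exact h1
    have h3 : n i % (p - 1) = k₀ := by
      rw [← h2, Nat.mod_eq_of_lt (by omega)]
    conv_lhs => rw [← Nat.mod_add_div (n i) (p - 1), h3]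
  have hev : ∀ᶠ r : ℕ in atTop, ∀ i ∈ s, ValGe p L
      (normPowSum p r (n i) - (1 - (p : ℚ) ^ ((n i : ℤ) - 1)) * _root_.bernoulli (n i)) :=
    (eventually_all_finset _).2 fun i _ => eventually_valGe_normPowSum_sub p (n i) L
  obtain ⟨r, hr1, hr2⟩ := (hev.and (eventually_valGe_normPowSum_sub p k₀ L)).exists
  obtain ⟨Q, hcoeff, hcongr, hzero, hnz⟩ := exists_interpolation r k₀ L hL
  refine ⟨Q, hcoeff, ?_, ?_, ?_, ?_⟩
  · intro i hi
    have h1 := hcongr (n i / (p - 1))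
    rw [← hclass i hi] at h1
    -- Since `n i ≥ L + 2` and `p B_n` is `p`-integral, the Euler factor at `n i` is invisible
    -- modulo `p^L`.
    have h2 : ValGe p L ((p : ℚ) ^ ((n i : ℤ) - 1) * _root_.bernoulli (n i)) :=
      (ValGe.zpow_self _).mul_of_le (valGe_bernoulli hp2 _) (by have := hn i hi; omega)
    convert (h1.sub (hr1 i hi)).add h2 using 1
    ring
  · intro h
    exact hzero (by omega)
  · intro h
    refine hnz fun hd => ?_
    have := Nat.eq_zero_of_dvd_of_lt hd (by omega)
    omega
  · intro h
    have hkk : (k₀ : ℤ) = k := by omega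
    have h1 := hcongr 0
    rw [mul_zero, add_zero] at h1
    have hb : bern k = _root_.bernoulli k₀ := by rw [bern, ← hkk, Int.toNat_natCast]
    rw [hb, ← hkk, Int.cast_natCast]
    convert h1.sub hr2 using 1
    ring

theorem valGe_sum_mul_bernoulli_sub_sum_mul_eval {L : ℕ} {M N : ℤ} (hN : N ≤ M + L)
    {s : Finset ι} {n : ι → ℕ} {G : ι → ℚ} (hG : ∀ i ∈ s, ValGe p M (G i)) {Q : ℚ[X]}
    (hQ : ∀ i ∈ s, ValGe p L (_root_.bernoulli (n i) - Q.eval (n i : ℚ))) :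
    ValGe p N (∑ i ∈ s, G i * _root_.bernoulli (n i) - ∑ i ∈ s, G i * Q.eval (n i : ℚ)) := by
  rw [← Finset.sum_sub_distrib]
  refine ValGe.sum fun i hi => ?_
  rw [← mul_sub]
  exact (hG i hi).mul_of_le (hQ i hi) hN

theorem eval_eq_coeff_zero_add_sum (Q : ℚ[X]) (x : ℚ) :
    Q.eval x = Q.coeff 0 + ∑ m ∈ Finset.range Q.natDegree, Q.coeff (m + 1) * x ^ (m + 1) := by
  rw [eval_eq_sum_range, Finset.sum_range_succ', add_comm]
  simp

/-- The congruence for one residue class, with main term only in the class of `0`. -/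
theorem valGe_class {L : ℕ} (hL : L + 3 ≤ p) {M N : ℤ} (hN : N ≤ M + L) {k : ℤ}
    (hk : |k| < (p : ℤ) - 1) {s : Finset ι} {n : ι → ℕ} {G : ι → ℚ}
    (hn : ∀ i ∈ s, L + 2 ≤ n i) (hmod : ∀ i ∈ s, (p : ℤ) - 1 ∣ n i - k)
    (hG : ∀ i ∈ s, ValGe p M (G i))
    (h : ∀ m : ℕ, 1 ≤ m → m ≤ L → ValGe p (N + 1 - m) (∑ i ∈ s, G i * (n i : ℚ) ^ m)) :
    ValGe p N (∑ i ∈ s, G i * _root_.bernoulli (n i)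
      - if k = 0 then (1 - 1 / (p : ℚ)) * ∑ i ∈ s, G i else 0) := by
  obtain ⟨Q, hcoeff, hQ, hzero, hnz, -⟩ := exists_bernoulli_interpolation hL hk s hn hmod
  have h1 := valGe_sum_mul_bernoulli_sub_sum_mul_eval hN hG hQ
  have h2 : ValGe p N (∑ i ∈ s, G i * Q.eval (n i : ℚ) - Q.coeff 0 * ∑ i ∈ s, G i) := by
    have e : ∑ i ∈ s, G i * Q.eval (n i : ℚ) - Q.coeff 0 * ∑ i ∈ s, G i
        = ∑ m ∈ Finset.range Q.natDegree,
          Q.coeff (m + 1) * ∑ i ∈ s, G i * (n i : ℚ) ^ (m + 1) := by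
      simp only [eval_eq_coeff_zero_add_sum Q, mul_add, Finset.sum_add_distrib, Finset.mul_sum]
      rw [Finset.sum_comm (s := Finset.range Q.natDegree)]
      simp only [mul_comm (Q.coeff 0), add_sub_cancel_left]
      exact Finset.sum_congr rfl fun i _ => Finset.sum_congr rfl fun m _ => by ring
    rw [e]
    refine ValGe.sum fun m _ => ?_
    -- In low degree the valuations `m` and `N - m` add up to `N`; in degree above `L` the
    -- coefficient alone has valuation at least `L`.
    by_cases hm : m + 1 ≤ L
    · exact (hcoeff (m + 1)).mul_of_le (h (m + 1) (by omega) hm) (by push_cast; linarith)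
    · refine (hcoeff (m + 1)).mul_of_le (M := M) (ValGe.sum fun i hi => ?_) (by push_cast; omega)
      exact (hG i hi).mul_of_le ((ValGe.natCast _).pow_zero_le _) (by simp)
  have h3 : ValGe p N (Q.coeff 0 * ∑ i ∈ s, G i
      - if k = 0 then (1 - 1 / (p : ℚ)) * ∑ i ∈ s, G i else 0) := by
    split_ifs with hk
    · rw [hzero hk, sub_self]
      exact ValGe.zero
    · rw [sub_zero]
      exact (hnz hk).mul_of_le (ValGe.sum hG) (by omega)
  convert (h1.add h2).add h3 using 1
  ring

/-- The congruence for the residue class of a positive `k`, with main term coming from `B_k`. -/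
theorem valGe_class_pos {L : ℕ} (hL : L + 3 ≤ p) {M N : ℤ} (hN : N ≤ M + L) {k : ℤ}
    (hk : |k| < (p : ℤ) - 1) (hk0 : 0 < k) {s : Finset ι} {n : ι → ℕ} {G : ι → ℚ}
    (hn : ∀ i ∈ s, L + 2 ≤ n i) (hmod : ∀ i ∈ s, (p : ℤ) - 1 ∣ n i - k)
    (hG : ∀ i ∈ s, ValGe p M (G i))
    (h : ∀ m : ℕ, 2 ≤ m → m ≤ L → ValGe p (N + 1 - m)
      (∑ i ∈ s, G i * ((n i : ℚ) ^ m - (k : ℚ) ^ (m - 1) * n i))) :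
    ValGe p N (∑ i ∈ s, G i * _root_.bernoulli (n i)
      - (1 - (p : ℚ) ^ (k - 1)) * (bern k / k) * ∑ i ∈ s, G i * n i) := by
  obtain ⟨Q, hcoeff, hQ, -, hnz, hpos⟩ := exists_bernoulli_interpolation hL hk s hn hmod
  have hkne : (k : ℚ) ≠ 0 := by exact_mod_cast hk0.ne'
  have hkinv : ValGe p 0 (k : ℚ)⁻¹ := by
    refine ValGe.inv_intCast fun hd => ?_
    have := Int.le_of_dvd hk0 hd
    have := (abs_lt.1 hk).2
    omega
  have hGn : ValGe p M (∑ i ∈ s, G i * n i) :=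
    ValGe.sum fun i hi => (hG i hi).mul_of_le (ValGe.natCast _) (by simp)
  have h1 := valGe_sum_mul_bernoulli_sub_sum_mul_eval hN hG hQ
  have h2 : ValGe p N (∑ i ∈ s, G i * Q.eval (n i : ℚ)
      - Q.eval (k : ℚ) * (k : ℚ)⁻¹ * ∑ i ∈ s, G i * n i) := by
    -- Subtracting `n Q(k)/k` turns each monomial `n^(m+1)` into `n^(m+1) - k^m n`.
    have e : ∑ i ∈ s, G i * Q.eval (n i : ℚ) - Q.eval (k : ℚ) * (k : ℚ)⁻¹ * ∑ i ∈ s, G i * n i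
        = (∑ m ∈ Finset.range Q.natDegree,
          Q.coeff (m + 1) * ∑ i ∈ s, G i * ((n i : ℚ) ^ (m + 1) - (k : ℚ) ^ m * n i))
          + (Q.coeff 0 * ∑ i ∈ s, G i
            - Q.coeff 0 * ((k : ℚ)⁻¹ * ∑ i ∈ s, G i * n i)) := by
      simp only [eval_eq_coeff_zero_add_sum Q, Finset.mul_sum]
      rw [Finset.sum_comm (s := Finset.range Q.natDegree), ← Finset.sum_sub_distrib,
        ← Finset.sum_sub_distrib, ← Finset.sum_add_distrib]
      refine Finset.sum_congr rfl fun i _ => ?_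
      have e1 : (∑ m ∈ Finset.range Q.natDegree, Q.coeff (m + 1) * (k : ℚ) ^ (m + 1)) * (k : ℚ)⁻¹
          = ∑ m ∈ Finset.range Q.natDegree, Q.coeff (m + 1) * (k : ℚ) ^ m := by
        rw [Finset.sum_mul]
        refine Finset.sum_congr rfl fun m _ => ?_
        rw [pow_succ]
        field_simp
      have e2 : ∑ m ∈ Finset.range Q.natDegree,
          Q.coeff (m + 1) * (G i * ((n i : ℚ) ^ (m + 1) - (k : ℚ) ^ m * n i))
          = G i * (∑ m ∈ Finset.range Q.natDegree, Q.coeff (m + 1) * (n i : ℚ) ^ (m + 1))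
            - (G i * n i) * ∑ m ∈ Finset.range Q.natDegree, Q.coeff (m + 1) * (k : ℚ) ^ m := by
        rw [Finset.mul_sum, Finset.mul_sum, ← Finset.sum_sub_distrib]
        exact Finset.sum_congr rfl fun m _ => by ring
      rw [e2, ← e1]
      ring
    rw [e]
    refine ValGe.add (ValGe.sum fun m _ => ?_) (ValGe.sub ?_ ?_)
    -- The linear monomial cancels identically, so condition 3 is needed only from exponent `2` on.
    · rcases Nat.eq_zero_or_pos m with rfl | hm0
      · simpa using ValGe.zero
      by_cases hm : m + 1 ≤ L
      · exact (hcoeff (m + 1)).mul_of_le (h (m + 1) (by omega) hm) (by push_cast; linarith)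
      · refine (hcoeff (m + 1)).mul_of_le (M := M) (ValGe.sum fun i hi => ?_) (by push_cast; omega)
        refine (hG i hi).mul_of_le (M := 0) (ValGe.sub ((ValGe.natCast _).pow_zero_le _) ?_)
          (by simp)
        exact ((ValGe.intCast k).pow_zero_le _).mul_of_le (ValGe.natCast _) (by simp)
    · exact (hnz hk0.ne').mul_of_le (ValGe.sum hG) (by omega)
    · exact (hnz hk0.ne').mul_of_le (hkinv.mul_of_le hGn (K := M) (by simp)) (by omega)
  have h3 := ((hpos hk0).mul_of_le hkinv (K := L) (by simp)).mul_of_le hGn (K := N) (by omega)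
  convert (h1.add h2).sub h3 using 1
  rw [div_eq_mul_inv]
  ring

end

/-! ### Main terms and assembly over residue classes -/

theorem eventually_le_eval {f : ℤ[X]} (hdeg : 0 < f.natDegree) (hlead : 0 < f.leadingCoeff)
    (c : ℤ) : ∀ᶠ p : ℕ in atTop, c ≤ f.eval (p : ℤ) := by
  have hinj := Int.cast_injective (α := ℚ)
  have h := tendsto_atTop_of_leadingCoeff_nonneg (f.map (Int.castRingHom ℚ))
    (by rw [degree_map_eq_of_injective hinj]; exact natDegree_pos_iff_degree_pos.1 hdeg)
    (by rw [leadingCoeff_map_of_injective hinj]; simpa using hlead.le)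
  filter_upwards [(h.comp tendsto_natCast_atTop_atTop).eventually_ge_atTop (c : ℚ)] with p hp
  have e : (f.map (Int.castRingHom ℚ)).eval (p : ℚ) = ((f.eval (p : ℤ) : ℤ) : ℚ) := by
    simp [eval_map]
  rw [Function.comp_apply, e] at hp
  exact_mod_cast hp

/-- As `p - 1` is even, `n` has the parity of `k`; `n ≥ 2` excludes `B_1`. -/
theorem bernoulli_eq_zero_of_odd_class {p n : ℕ} (hp : p.Prime) (hp2 : p ≠ 2) {k : ℤ}
    (hk : ¬ Even k) (hn : 2 ≤ n) (hmod : (p : ℤ) - 1 ∣ n - k) : _root_.bernoulli n = 0 := by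
  refine bernoulli_eq_zero_of_odd ?_ (by omega)
  have h1 : Odd (p : ℤ) := by exact_mod_cast hp.odd_of_ne_two hp2
  have h2 : Even ((n : ℤ) - k) := (even_iff_two_dvd.2
    ((even_iff_two_dvd.1 (h1.sub_odd odd_one)).trans hmod))
  have h3 : Odd (n : ℤ) := by
    have := h2.add_odd (Int.not_even_iff_odd.1 hk)
    rwa [sub_add_cancel] at this
  exact_mod_cast h3

/-- The value at `p` of the summand that a pair `(f, g)` contributes to the right-hand side. -/
noncomputable def mainTerm (f : ℤ[X]) (g : RatFunc ℚ) (p : ℕ) : ℚ :=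
  if f.eval 1 = 0 then (1 - 1 / (p : ℚ)) * evalAt p g
  else if 2 ≤ f.eval 1 then
    (1 - (p : ℚ) ^ (f.eval 1 - 1)) * (bern (f.eval 1) / ((f.eval 1 : ℤ) : ℚ))
      * (evalAt p g * ((f.eval (p : ℤ) : ℤ) : ℚ))
  else 0

theorem eventually_valGe_evalAt_sub_sum_mainTerm {N : ℤ} {n : ℕ} {f : Fin n → ℤ[X]}
    {g₀ : RatFunc ℚ} {g : Fin n → RatFunc ℚ}
    (h : (N : WithTop ℤ) ≤ tVal (g₀
      - (1 - 1 / RatFunc.X) * ∑ i with (f i).eval 1 = 0, g i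
      - ∑ i with 2 ≤ (f i).eval 1,
          (1 - RatFunc.X ^ ((f i).eval 1 - 1))
            * RatFunc.C (bern ((f i).eval 1) / (((f i).eval 1 : ℤ) : ℚ)) * g i
            * toRatFunc (f i))) :
    ∀ᶠ p : ℕ in atTop, p.Prime → ValGe p N (evalAt p g₀ - ∑ i, mainTerm (f i) (g i) p) := by
  set A : RatFunc ℚ := 1 - 1 / RatFunc.X with hA
  set B : Fin n → RatFunc ℚ := fun i => 1 - RatFunc.X ^ ((f i).eval 1 - 1) with hB
  set b : Fin n → RatFunc ℚ :=
    fun i => RatFunc.C (bern ((f i).eval 1) / (((f i).eval 1 : ℤ) : ℚ)) with hb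
  have hAe : ∀ᶠ p : ℕ in atTop, evalAt p A = 1 - 1 / (p : ℚ) := by
    filter_upwards [eventually_evalAt_sub 1 (1 / RatFunc.X), eventually_evalAt_X_zpow (-1)]
      with p h1 h2
    rw [hA, h1, one_div, one_div, ← zpow_neg_one, h2, zpow_neg_one]
    simp [evalAt]
  have hBe : ∀ᶠ p : ℕ in atTop, ∀ i, evalAt p (B i * b i * g i * toRatFunc (f i))
      = (1 - (p : ℚ) ^ ((f i).eval 1 - 1)) * (bern ((f i).eval 1) / (((f i).eval 1 : ℤ) : ℚ))
        * (evalAt p (g i) * (((f i).eval (p : ℤ) : ℤ) : ℚ)) := by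
    refine eventually_all.2 fun i => ?_
    filter_upwards [eventually_evalAt_sub 1 (RatFunc.X ^ ((f i).eval 1 - 1)),
      eventually_evalAt_X_zpow ((f i).eval 1 - 1), eventually_evalAt_mul (B i) (b i),
      eventually_evalAt_mul (B i * b i) (g i),
      eventually_evalAt_mul (B i * b i * g i) (toRatFunc (f i))] with p h1 h2 h3 h4 h5
    rw [h5, h4, h3, evalAt_toRatFunc, hB, hb, h1, h2, evalAt_C, mul_assoc]
    simp [evalAt]
  filter_upwards [eventually_valGe_evalAt h, hAe, hBe,
    eventually_evalAt_sub (g₀ - A * ∑ i with (f i).eval 1 = 0, g i)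
      (∑ i with 2 ≤ (f i).eval 1, B i * b i * g i * toRatFunc (f i)),
    eventually_evalAt_sub g₀ (A * ∑ i with (f i).eval 1 = 0, g i),
    eventually_evalAt_mul A (∑ i with (f i).eval 1 = 0, g i),
    eventually_evalAt_sum {i | (f i).eval 1 = 0} g,
    eventually_evalAt_sum {i | 2 ≤ (f i).eval 1} fun i => B i * b i * g i * toRatFunc (f i)]
    with p h1 h2 h3 h4 h5 h6 h7 h8 hpr
  have h9 := h1 hpr
  rw [h4, h5, h6, h7, h8, h2] at h9
  convert h9 using 1
  rw [sub_sub, Finset.mul_sum, Finset.sum_filter, Finset.sum_filter, ← Finset.sum_add_distrib]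
  congr 1
  refine Finset.sum_congr rfl fun i _ => ?_
  rw [h3 i, mainTerm]
  split_ifs with ha hb <;> first | omega | simp

theorem exists_int_valuation_bound {N : ℤ} {n : ℕ} {g : Fin n → RatFunc ℚ} {g₀ : RatFunc ℚ}
    {M : WithTop ℤ} (hM : M = min (tVal g₀) (Finset.univ.inf fun i => tVal (g i))) :
    ∃ M₀ : ℤ, (∀ i, (M₀ : WithTop ℤ) ≤ tVal (g i)) ∧
      ∀ m : ℕ, 1 ≤ m → m + M₀ ≤ N → ((m : ℤ) : WithTop ℤ) + M ≤ (N : WithTop ℤ) := by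
  have hle : ∀ i, M ≤ tVal (g i) := fun i =>
    hM ▸ (min_le_right _ _).trans (Finset.inf_le (Finset.mem_univ i))
  clear hM
  induction M using WithTop.recTopCoe with
  -- All `g i` vanish, so any integer bound works; `N` leaves no admissible `m ≥ 1`.
  | top => exact ⟨N, fun i => le_top.trans (hle i), fun m h1 h2 => by omega⟩
  | coe M₀ => exact ⟨M₀, hle, fun m _ h2 => by exact_mod_cast h2⟩

theorem theorem1 (N : ℤ) (n : ℕ) (f : Fin n → Polynomial ℤ)
    (hf_deg : ∀ i, 0 < (f i).natDegree) (hf_lead : ∀ i, 0 < (f i).leadingCoeff)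
    (g₀ : RatFunc ℚ) (g : Fin n → RatFunc ℚ)
    (M : WithTop ℤ) (hM : M = min (tVal g₀) (Finset.univ.inf fun i => tVal (g i)))
    (h1 : (N : WithTop ℤ) ≤ tVal (g₀
      - (1 - 1 / RatFunc.X) * ∑ i with (f i).eval 1 = 0, g i
      - ∑ i with 2 ≤ (f i).eval 1,
          (1 - RatFunc.X ^ ((f i).eval 1 - 1))
            * RatFunc.C (bern ((f i).eval 1) / (((f i).eval 1 : ℤ) : ℚ)) * g i * toRatFunc (f i)))
    (h2 : ∀ k : ℤ, (∃ i, (f i).eval 1 = k) → Even k → k ≤ 0 →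
      ∀ m : ℕ, 1 ≤ m → ((m : ℤ) : WithTop ℤ) + M ≤ (N : WithTop ℤ) →
        ((N + 1 - m : ℤ) : WithTop ℤ) ≤
          tVal (∑ i with (f i).eval 1 = k, g i * toRatFunc (f i) ^ m))
    (h3 : ∀ k : ℤ, (∃ i, (f i).eval 1 = k) → Even k → 0 < k →
      ∀ m : ℕ, 2 ≤ m → ((m : ℤ) : WithTop ℤ) + M ≤ (N : WithTop ℤ) →
        ((N + 1 - m : ℤ) : WithTop ℤ) ≤
          tVal (∑ i with (f i).eval 1 = k,
            g i * (toRatFunc (f i) ^ m - (k : RatFunc ℚ) ^ (m - 1) * toRatFunc (f i)))) :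
    ∃ P : ℕ, ∀ p : ℕ, p.Prime → P ≤ p →
      RatCongr p N (∑ i, evalAt (p : ℚ) (g i) * bern ((f i).eval (p : ℤ))) (evalAt (p : ℚ) g₀) := by
  obtain ⟨M₀, hgM, hmM⟩ := exists_int_valuation_bound (N := N) hM
  -- Modulo `p^L` suffices because `M₀ + L ≥ N`. If `N < M₀`, then `L = 0` and no moment condition
  -- is used.
  set L : ℕ := (N - M₀).toNat with hL
  set K : Finset ℤ := Finset.univ.image fun i => (f i).eval 1 with hK
  have hKex : ∀ k ∈ K, ∃ i, (f i).eval 1 = k := fun k hk => by simpa [hK] using hk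
  have ev1 : ∀ᶠ p : ℕ in atTop, ∀ i, ((L + 2 : ℕ) : ℤ) ≤ (f i).eval (p : ℤ) :=
    eventually_all.2 fun i => eventually_le_eval (hf_deg i) (hf_lead i) _
  have ev2 : ∀ᶠ p : ℕ in atTop, ∀ i, p.Prime → ValGe p M₀ (evalAt p (g i)) :=
    eventually_all.2 fun i => eventually_valGe_evalAt (hgM i)
  have ev3 : ∀ᶠ p : ℕ in atTop, ∀ k ∈ K, |k| < (p : ℤ) - 1 := by
    refine (eventually_all_finset _).2 fun k _ => ?_
    filter_upwards [eventually_ge_atTop (|k| + 2).toNat] with p hp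
    omega
  have ev4 : ∀ᶠ p : ℕ in atTop, ∀ k ∈ K, ∀ m ∈ Finset.range (L + 1), Even k → k ≤ 0 → 1 ≤ m →
      p.Prime → ValGe p (N + 1 - m) (∑ i with (f i).eval 1 = k,
        evalAt p (g i) * (((f i).eval (p : ℤ) : ℤ) : ℚ) ^ m) := by
    refine (eventually_all_finset _).2 fun k hk => (eventually_all_finset _).2 fun m hm => ?_
    simp only [eventually_imp_distrib_left]
    intro he hk0 hm1
    have hm' := Finset.mem_range.1 hm
    filter_upwards [eventually_valGe_evalAt (h2 k (hKex k hk) he hk0 m hm1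
        (hmM m hm1 (by omega))),
      eventually_evalAt_sum {i | (f i).eval 1 = k} fun i => g i * toRatFunc (f i) ^ m,
      eventually_all.2 fun i => eventually_evalAt_mul (g i) (toRatFunc (f i) ^ m),
      eventually_all.2 fun i => eventually_evalAt_pow (toRatFunc (f i)) m] with p a1 a2 a3 a4 hpr
    have := a1 hpr
    rw [a2] at this
    simpa only [a3, a4, evalAt_toRatFunc] using this
  have ev5 : ∀ᶠ p : ℕ in atTop, ∀ k ∈ K, ∀ m ∈ Finset.range (L + 1), Even k → 0 < k → 2 ≤ m →
      p.Prime → ValGe p (N + 1 - m) (∑ i with (f i).eval 1 = k,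
        evalAt p (g i) * ((((f i).eval (p : ℤ) : ℤ) : ℚ) ^ m
          - (k : ℚ) ^ (m - 1) * (((f i).eval (p : ℤ) : ℤ) : ℚ))) := by
    refine (eventually_all_finset _).2 fun k hk => (eventually_all_finset _).2 fun m hm => ?_
    simp only [eventually_imp_distrib_left]
    intro he hk0 hm2
    have hm' := Finset.mem_range.1 hm
    have hc : (k : RatFunc ℚ) ^ (m - 1) = RatFunc.C ((k : ℚ) ^ (m - 1)) := by simp
    have hv := h3 k (hKex k hk) he hk0 m hm2 (hmM m (by omega) (by omega))
    rw [hc] at hv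
    filter_upwards [eventually_valGe_evalAt hv,
      eventually_evalAt_sum {i | (f i).eval 1 = k} fun i =>
        g i * (toRatFunc (f i) ^ m - RatFunc.C ((k : ℚ) ^ (m - 1)) * toRatFunc (f i)),
      eventually_all.2 fun i => eventually_evalAt_mul (g i)
        (toRatFunc (f i) ^ m - RatFunc.C ((k : ℚ) ^ (m - 1)) * toRatFunc (f i)),
      eventually_all.2 fun i => eventually_evalAt_sub (toRatFunc (f i) ^ m)
        (RatFunc.C ((k : ℚ) ^ (m - 1)) * toRatFunc (f i)),
      eventually_all.2 fun i =>
        eventually_evalAt_mul (RatFunc.C ((k : ℚ) ^ (m - 1))) (toRatFunc (f i)),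
      eventually_all.2 fun i => eventually_evalAt_pow (toRatFunc (f i)) m]
      with p a1 a2 a3 a4 a5 a6 hpr
    have := a1 hpr
    rw [a2] at this
    simpa only [a3, a4, a5, a6, evalAt_toRatFunc, evalAt_C] using this
  obtain ⟨P, hP⟩ := eventually_atTop.1 (ev1.and (ev2.and (ev3.and (ev4.and (ev5.and
    ((eventually_valGe_evalAt_sub_sum_mainTerm h1).and (eventually_ge_atTop (L + 3))))))))
  refine ⟨P, fun p hpr hPp => ?_⟩
  obtain ⟨e1, e2, e3, e4, e5, e6, e7⟩ := hP p hPp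
  have := Fact.mk hpr
  set ν : Fin n → ℕ := fun i => ((f i).eval (p : ℤ)).toNat with hν
  have hνZ : ∀ i, ((ν i : ℕ) : ℤ) = (f i).eval (p : ℤ) := fun i =>
    Int.toNat_of_nonneg (le_trans (by positivity) (e1 i))
  have hνQ : ∀ i, (((f i).eval (p : ℤ) : ℤ) : ℚ) = (ν i : ℚ) := fun i => by
    rw [← hνZ, Int.cast_natCast]
  have hνL : ∀ i, L + 2 ≤ ν i := fun i => by exact_mod_cast (hνZ i).symm ▸ e1 i
  have hmod : ∀ k i, (f i).eval 1 = k → (p : ℤ) - 1 ∣ ν i - k := by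
    rintro k i rfl
    rw [hνZ]
    exact sub_dvd_eval_sub _ _ _
  have hclass : ∀ k ∈ K, ValGe p N (∑ i with (f i).eval 1 = k,
      (evalAt p (g i) * _root_.bernoulli (ν i) - mainTerm (f i) (g i) p)) := by
    intro k hk
    by_cases he : Even k
    swap
    -- For odd `k` both terms are zero; `k = 1` falls under neither case of `mainTerm`, so `B_1`
    -- never enters.
    · refine ValGe.sum fun i hi => ?_
      have hi : (f i).eval 1 = k := by simpa using hi
      have hb := bernoulli_eq_zero_of_odd_class hpr (by omega) he
        (by have := hνL i; omega) (hmod k i hi)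
      have hm : mainTerm (f i) (g i) p = 0 := by
        rw [mainTerm, hi]
        split_ifs with c1 c2
        · exact absurd (c1 ▸ Even.zero) he
        · have : bern k = 0 := by
            refine bernoulli_eq_zero_of_odd ?_ (by omega)
            have h4 := Int.not_even_iff_odd.1 he
            have h5 : ((k.toNat : ℕ) : ℤ) = k := by omega
            rw [← h5] at h4
            exact_mod_cast h4
          simp [this]
        · rfl
      rw [hb, hm]
      simpa using ValGe.zero
    have a1 : ∀ i ∈ ({i | (f i).eval 1 = k} : Finset (Fin n)), L + 2 ≤ ν i := fun i _ => hνL i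
    have a2 : ∀ i ∈ ({i | (f i).eval 1 = k} : Finset (Fin n)), (p : ℤ) - 1 ∣ ν i - k :=
      fun i hi => hmod k i (by simpa using hi)
    have a3 : ∀ i ∈ ({i | (f i).eval 1 = k} : Finset (Fin n)), ValGe p M₀ (evalAt p (g i)) :=
      fun i _ => e2 i hpr
    rw [Finset.sum_sub_distrib]
    rcases le_or_gt k 0 with hk0 | hk0
    · have key := valGe_class e7 (M := M₀) (N := N) (by omega) (e3 k hk) a1 a2 a3
        fun m hm1 hmL => by
          simpa only [hνQ] using e4 k hk m (Finset.mem_range.2 (by omega)) he hk0 hm1 hpr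
      convert key using 2
      split_ifs with hkz
      · rw [Finset.mul_sum]
        refine Finset.sum_congr rfl fun i hi => ?_
        have hi : (f i).eval 1 = k := by simpa using hi
        rw [mainTerm, if_pos (hi.trans hkz)]
      · refine Finset.sum_eq_zero fun i hi => ?_
        have hi : (f i).eval 1 = k := by simpa using hi
        rw [mainTerm, hi, if_neg hkz, if_neg (by omega)]
    · have key := valGe_class_pos e7 (M := M₀) (N := N) (by omega) (e3 k hk) hk0 a1 a2 a3
        fun m hm2 hmL => by
          simpa only [hνQ] using e5 k hk m (Finset.mem_range.2 (by omega)) he hk0 hm2 hpr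
      convert key using 2
      rw [Finset.mul_sum]
      refine Finset.sum_congr rfl fun i hi => ?_
      have hi : (f i).eval 1 = k := by simpa using hi
      obtain ⟨t, ht⟩ := he
      rw [mainTerm, hi, if_neg (by omega), if_pos (by omega), hνQ]
  have htotal : ValGe p N (∑ i, (evalAt p (g i) * _root_.bernoulli (ν i)
      - mainTerm (f i) (g i) p)) := by
    rw [← Finset.sum_fiberwise_of_maps_to (t := K) (g := fun i => (f i).eval 1)
      (fun i _ => Finset.mem_image_of_mem _ (Finset.mem_univ i))]
    exact ValGe.sum hclass
  refine ValGe.ratCongr ?_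
  convert htotal.sub (e6 hpr) using 1
  rw [Finset.sum_sub_distrib]
  simp only [bern, hν]
  ring
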